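/- **Conventions.** A bipartite (multi)graph with parameters $(n,m,d)$ is a function $G:\{0,1\}^n\times\{0,1\}^d\to\{0,1\}^m$: $G(x,e)$ is the right end of the edge number $e$ of the left vertex $x$. It is encoded by the list of its edges, a string of $2^n2^dm$ bits. Put $D=2^d$, $M=2^m$, $K=2^k$. $G$ is a *$(k,\varepsilon)$-extractor* if for every random $x$ in $\{0,1\}^n$ that takes each value with probability at most $2^{-k}$, for $u$ uniform on $\{0,1\}^d$ and independent of $x$, and for every $Y\subseteq\{0,1\}^m$, one has $\bigl|\Pr[G(x,u)\in Y]-|Y|/M\bigr|\le\varepsilon$. For $S\subseteq\{0,1\}^n$ the *$\alpha$-clot* is the set of right vertices that receive more than $\alpha DK/M$ edges from $S$ (counted with multiplicity). A vertex $x\in S$ is *$\alpha$-congested* for $S$ if all its neighbours lie in the $\alpha$-clot for $S$. $G$ is *$(\alpha,\beta)$-low-congesting* with respect to a system $\mathcal S$ of subsets of $\{0,1\}^n$ if every $S\in\mathcal S$ has fewer than $\beta K$ $\alpha$-congested vertices. For a two-argument Turing machine $V$ (two read-only input tapes, finitely many work tapes, a write-only output tape), $C_V^s(x\mid b)$ is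 the length of a shortest program $p$ such that $V(p,b)$ halts with output $x$ and visits at most $s$ work tape cells ($\infty$ if there is none), and $$\mathcal S_k=\bigl\{S\subseteq\{0,1\}^n : \exists b\in\{0,1\}^n\ \exists s\in\mathbb N\ \ S=\{x\in\{0,1\}^n : C_V^s(x\mid b)<k\}\bigr\}.$$ A circuit is a finite acyclic network of AND and OR gates of unbounded fan-in and NOT gates. Its size is the number of gates and its depth is the largest number of gates on a directed path. Circuits are non-uniform. **Lemma.** There is an absolute constant $h$ such that for every $c\in\mathbb N$ there is an $A\in\mathbb N$ with the following property. Let $n,m,d,k$ be non-negative integers with $1<k<n$ and $2^n2^dm\le 2^{cn}$ (so the codes of graphs have length $2^{O(n)}$), let $\varepsilon>0$ be real, and let $V$ be any two-argument Turing machine (for instance an optimal one). Then there is a circuit $C$ of size at most $2^{An}$ and depth at most $h$, whose inputs are the codes of bipartite graphs with parameters $(n,m,d)$, such that for every such graph $G$: * if $G$ is a $(k,\varepsilon)$-extractor, then $C(G)=1$; * if $C(G)=1$, then $G$ is $(2.01,\,2.01\varepsilon)$-low-congesting with respect to $\mathcal S_k$. -/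

import Mathlib

/-! ### Boolean circuits with unbounded fan-in -/

/-- A gate whose incoming wires have labels in `W`: a conjunction or a disjunction of
arbitrary (finite) fan-in, or a negation. -/
inductive Gate (W : Type) : Type
  | and (s : Finset W) : Gate W
  | or (s : Finset W) : Gate W
  | not (w : W) : Gate W

/-- The set of incoming wires of a gate. -/
def Gate.inputs {W : Type} : Gate W → Finset W
  | .and s => s
  | .or s => s
  | .not w => {w}

/-- The truth value of a gate, given the truth values of the wires. -/
def Gate.eval {W : Type} (v : W → Prop) : Gate W → Prop
  | .and s => ∀ w ∈ s, v w
  | .or s => ∃ w ∈ s, v w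
  | .not w => ¬ v w

/-- A (non-uniform) Boolean circuit with input bits indexed by `ι`: a finite directed acyclic
graph of gates. A wire `Sum.inl i` carries the `i`-th input bit, and a wire `Sum.inr g` carries
the value of the gate `g`. -/
structure Circuit (ι : Type) where
  Node : Type
  [fintypeNode : Fintype Node]
  gate : Node → Gate (ι ⊕ Node)
  acyclic : WellFounded fun h g : Node => Sum.inr h ∈ (gate g).inputs
  output : ι ⊕ Node

attribute [instance] Circuit.fintypeNode

namespace Circuit

variable {ι : Type} (C : Circuit ι)

/-- The size of a circuit is the number of its gates. -/
def size : ℕ := Fintype.card C.Node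

/-- The depth of a gate: the largest number of gates on a directed path that ends in it. -/
noncomputable def nodeDepth : C.Node → ℕ :=
  C.acyclic.fix fun g ih =>
    ((C.gate g).inputs.attach.sup fun w =>
      match w with
      | ⟨Sum.inl _, _⟩ => 0
      | ⟨Sum.inr h, hh⟩ => ih h hh) + 1

/-- The depth of a circuit: the largest number of gates on a directed path. -/
noncomputable def depth : ℕ := Finset.univ.sup C.nodeDepth

/-- The value of a gate on the input `x`, by recursion along the circuit. -/
def nodeVal (x : ι → Bool) : C.Node → Prop :=
  C.acyclic.fix fun g ih =>
    (C.gate g).eval fun w =>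
      match w with
      | Sum.inl i => x i = true
      | Sum.inr h => ∃ hh : Sum.inr h ∈ (C.gate g).inputs, ih h hh

/-- The value of a wire on the input `x`. -/
def wireVal (x : ι → Bool) : ι ⊕ C.Node → Prop
  | Sum.inl i => x i = true
  | Sum.inr g => C.nodeVal x g

/-- `C(x) = 1`. -/
def Accepts (x : ι → Bool) : Prop := C.wireVal x C.output

/-- The value of a gate is the value of its operation on the values of its incoming wires. -/
theorem nodeVal_iff (x : ι → Bool) (g : C.Node) :
    C.nodeVal x g ↔ (C.gate g).eval (C.wireVal x) := by
  have key : ∀ w ∈ (C.gate g).inputs,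
      ((match w with
        | Sum.inl i => x i = true
        | Sum.inr h => ∃ _ : Sum.inr h ∈ (C.gate g).inputs, C.nodeVal x h) ↔
        C.wireVal x w) := by
    intro w hw
    cases w with
    | inl i => exact Iff.rfl
    | inr h => exact ⟨fun ⟨_, hv⟩ => hv, fun hv => ⟨hw, hv⟩⟩
  have h1 : C.nodeVal x g = (C.gate g).eval fun w =>
      match w with
      | Sum.inl i => x i = true
      | Sum.inr h => ∃ _ : Sum.inr h ∈ (C.gate g).inputs, C.nodeVal x h := by
    unfold nodeVal
    rw [WellFounded.fix_eq]
  rw [h1]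
  generalize C.gate g = a at key
  cases a with
  | and s => exact forall₂_congr key
  | or s =>
    constructor
    · rintro ⟨w, hw, hv⟩
      exact ⟨w, hw, (key w hw).1 hv⟩
    · rintro ⟨w, hw, hv⟩
      exact ⟨w, hw, (key w hw).2 hv⟩
  | not w => exact not_congr (key w (Finset.mem_singleton_self w))

/-- The recursive equation for the depth of a gate. -/
theorem nodeDepth_eq (g : C.Node) :
    C.nodeDepth g = ((C.gate g).inputs.sup (Sum.elim (fun _ => 0) C.nodeDepth)) + 1 := by
  have h1 : C.nodeDepth g = ((C.gate g).inputs.attach.sup fun w =>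
      match w with
      | ⟨Sum.inl _, _⟩ => 0
      | ⟨Sum.inr h, _⟩ => C.nodeDepth h) + 1 := by
    unfold nodeDepth
    rw [WellFounded.fix_eq]
  rw [h1, ← Finset.sup_attach (C.gate g).inputs]
  congr 1
  refine Finset.sup_congr rfl fun w _ => ?_
  rcases w with ⟨w | w, hw⟩ <;> rfl

end Circuit

/-! ### Two-argument Turing machines and space-bounded Kolmogorov complexity -/

/-- What a machine does in one step: the new state, the moves of the heads on the two read-only
input tapes, the symbols written on the work tapes, the moves of the heads on the work tapes,
and possibly a bit appended to the write-only output tape. -/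
structure TMAction (Q Γ : Type) (t : ℕ) where
  state : Q
  progMove : SignType
  argMove : SignType
  write : Fin t → Γ
  move : Fin t → SignType
  emit : Option Bool

/-- A deterministic two-argument Turing machine: two read-only input tapes (for the "program"
and for the "argument"), finitely many two-way infinite work tapes over a finite alphabet, and a
one-way write-only output tape. A machine halts when its transition is `none`. The end markers of
the input tapes are read as `none`. -/
structure TwoArgTM where
  Q : Type
  Γ : Type
  [finiteQ : Finite Q]
  [finiteΓ : Finite Γ]
  tapes : ℕ
  start : Q
  blank : Γ
  trans : Q → Option Bool → Option Bool → (Fin tapes → Γ) → Option (TMAction Q Γ tapes)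

namespace TwoArgTM

/-- A configuration. -/
structure Config (V : TwoArgTM) where
  state : V.Q
  progPos : ℤ
  argPos : ℤ
  tape : Fin V.tapes → ℤ → V.Γ
  head : Fin V.tapes → ℤ
  out : List Bool

/-- The symbol in cell `i` of an input tape that holds `w` in the cells `0, …, |w| - 1`. -/
def readInput (w : List Bool) (i : ℤ) : Option Bool :=
  if 0 ≤ i then w[i.toNat]? else none

/-- A move on an input tape that holds `w`: the head does not leave the word together with its
two end markers, in the cells `-1` and `|w|`. -/
def moveInput (w : List Bool) (i : ℤ) (δ : SignType) : ℤ :=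
  max (-1) (min (w.length : ℤ) (i + (δ : ℤ)))

variable (V : TwoArgTM)

/-- The initial configuration. -/
def init : V.Config where
  state := V.start
  progPos := 0
  argPos := 0
  tape := fun _ _ => V.blank
  head := fun _ => 0
  out := []

/-- One step of the machine on the program `p` and the argument `y`; `none` if it halts. -/
def step (p y : List Bool) (c : V.Config) : Option V.Config :=
  (V.trans c.state (readInput p c.progPos) (readInput y c.argPos)
      fun i => c.tape i (c.head i)).map fun a =>
    { state := a.state
      progPos := moveInput p c.progPos a.progMove
      argPos := moveInput y c.argPos a.argMove
      tape := fun i => Function.update (c.tape i) (c.head i) (a.write i)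
      head := fun i => c.head i + (a.move i : ℤ)
      out := c.out ++ a.emit.toList }

/-- The configuration after `T` steps (the last one, if the machine has halted before). -/
def run (p y : List Bool) (T : ℕ) : V.Config :=
  (fun c => (V.step p y c).getD c)^[T] V.init

/-- The number of work tape cells visited during the first `T` steps. -/
def space (p y : List Bool) (T : ℕ) : ℕ :=
  ∑ i : Fin V.tapes, ((Finset.range (T + 1)).image fun τ => (V.run p y τ).head i).card

/-- `V(p, y) = x`, and the computation uses at most `s` cells of memory. -/
def ComputesInSpace (s : ℕ) (p y x : List Bool) : Prop :=
  ∃ T : ℕ, V.step p y (V.run p y T) = none ∧ (V.run p y T).out = x ∧ V.space p y T ≤ s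

/-- Kolmogorov complexity of `x` conditional on `y` in space `s` with respect to `V`: the length
of a shortest program that transforms `y` to `x` in space `s` (`⊤` if there is none). -/
noncomputable def KS (s : ℕ) (x y : List Bool) : ℕ∞ :=
  ⨅ (p : List Bool) (_ : V.ComputesInSpace s p y x), (p.length : ℕ∞)

end TwoArgTM

/-! ### Bipartite graphs, extractors and low-congesting graphs -/

/-- Binary strings of length `n`. -/
abbrev BitStr (n : ℕ) : Type := Fin n → Bool

/-- The system of the sets `{x | KS^s(x | b) < k}` of strings of length `n`, where `b` is a string
of length `n` and `s` is a space bound. -/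
def relevantSystem (V : TwoArgTM) (n k : ℕ) : Set (Set (BitStr n)) :=
  {S | ∃ (b : BitStr n) (s : ℕ), S = {x | V.KS s (List.ofFn x) (List.ofFn b) < (k : ℕ∞)}}

/-- A bipartite multigraph with parameters `(n, m, d)`: the left part is `{0,1}^n`, the right part
is `{0,1}^m`, and `G x e` is the right end of the edge number `e ∈ {0,1}^d` of the left vertex
`x`. -/
abbrev BipGraph (n m d : ℕ) : Type := BitStr n → BitStr d → BitStr m

/-- Positions in the code of a graph: bit `j` of the right end of edge `e` of the left
vertex `x`. There are `2^n * 2^d * m` of them. -/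
abbrev CodePos (n m d : ℕ) : Type := BitStr n × BitStr d × Fin m

namespace BipGraph

variable {n m d : ℕ}

/-- The code of a graph: the list of its edges, each given by the `m` bits of its right end. -/
def encode (G : BipGraph n m d) : CodePos n m d → Bool := fun q => G q.1 q.2.1 q.2.2

/-- `(k, ε)`-extractors: if `x` is distributed on `{0,1}^n` so that no string has probability
greater than `2^{-k}`, and `u` is uniform on `{0,1}^d` and independent of `x`, then for each set
`Y ⊆ {0,1}^m` the probability that `G x u ∈ Y` differs from `|Y| / 2^m` by at most `ε`. -/
def IsExtractor (k : ℕ) (ε : ℝ) (G : BipGraph n m d) : Prop :=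
  ∀ p : PMF (BitStr n), (∀ x, p x ≤ (2⁻¹ : ENNReal) ^ k) →
    ∀ Y : Finset (BitStr m),
      |((p.bind fun x => (PMF.uniformOfFintype (BitStr d)).map (G x)).toOuterMeasure
          (Y : Set (BitStr m))).toReal - (Y.card : ℝ) / 2 ^ m| ≤ ε

/-- The `α`-clot for `S`: the right vertices whose indegree from `S` (the number of edges from `S`,
with multiplicity) is greater than `α D K / M`, where `D = 2^d`, `K = 2^k`, `M = 2^m`. -/
def clot (k : ℕ) (α : ℝ) (G : BipGraph n m d) (S : Set (BitStr n)) : Set (BitStr m) :=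
  {y | α * 2 ^ d * 2 ^ k / 2 ^ m < ({q : BitStr n × BitStr d | q.1 ∈ S ∧ G q.1 q.2 = y}.ncard : ℝ)}

/-- The `α`-congested vertices for `S`: all their neighbours lie in the `α`-clot for `S`. -/
def congested (k : ℕ) (α : ℝ) (G : BipGraph n m d) (S : Set (BitStr n)) : Set (BitStr n) :=
  {x | x ∈ S ∧ ∀ e, G x e ∈ G.clot k α S}

/-- `(α, β)`-low-congesting graphs with respect to a system `𝒮` of sets of left vertices. -/
def IsLowCongesting (k : ℕ) (α β : ℝ) (𝒮 : Set (Set (BitStr n))) (G : BipGraph n m d) : Prop :=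
  ∀ S ∈ 𝒮, ((G.congested k α S).ncard : ℝ) < β * 2 ^ k

end BipGraph

/-! An extractor is low-congesting with the sharper constants 2 and 2ε, for every set of at most `2
^ k` left vertices (`IsExtractor.ncard_congested_lt`). The edges of such a set hit its 2-clot with a
frequency more than twice the density of the clot; the extractor property bounds the excess by ε, so
the frequency is below 2ε, and every congested vertex spends all its edges there.

The gap between 2 and 2.01 leaves room for approximate counting, which bounded depth can do although
exact counting cannot be afforded. A random OR of ANDs of ORs of sampled elements errs on a given
set with probability below `2 ^ (-N)`, where the universe has at most `N` elements. A union bound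
over all subsets then fixes one formula, polynomial in `N`, that separates size at most `a` from
size at least `(1 + 1/t) a` (`exists_approximate_counter`).

The system of sets can be hard-wired: for fixed `b` the sets form a chain as the space bound grows,
so there are at most `2 ^ (2n + 1)` of them (`card_relevantSystem_le`), and none has `2 ^ k`
elements because programs of length below `k` are too few. For each set the circuit uses one counter
on edges, to decide whether an end of an edge is in the clot, and one on vertices, to decide whether
too many are congested. The right vertices, possibly far more than `2 ^ (c * n)`, are never
enumerated: each clot test is attached to an edge and counts the edges with the same end. -/

/-! ### Composition of circuits -/

namespace Gate

/-- Relabelling of the wires of a gate. -/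
noncomputable def map {W W' : Type} (f : W → W') : Gate W → Gate W'
  | .and s => .and (by classical exact s.image f)
  | .or s => .or (by classical exact s.image f)
  | .not w => .not (f w)

theorem mem_inputs_map {W W' : Type} (f : W → W') (g : Gate W) (w : W') :
    w ∈ (g.map f).inputs ↔ ∃ v ∈ g.inputs, f v = w := by
  cases g <;> simp [map, inputs, eq_comm]

theorem eval_map {W W' : Type} (f : W → W') (g : Gate W) (v : W' → Prop) :
    (g.map f).eval v ↔ g.eval (v ∘ f) := by
  cases g <;> simp [map, eval]

theorem eval_congr {W : Type} (g : Gate W) {v v' : W → Prop} (h : ∀ w, v w ↔ v' w) :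
    g.eval v ↔ g.eval v' := by
  rw [show v = v' from funext fun w => propext (h w)]

end Gate

namespace Circuit

variable {ι J : Type}

/-- The wire of `combine` that corresponds to a wire of the component number `j`. -/
def embedWire (C : J → Circuit ι) (j : J) : ι ⊕ (C j).Node → ι ⊕ Option (Σ j, (C j).Node) :=
  Sum.map id fun g => some ⟨j, g⟩

/-- The gates of `combine`. -/
noncomputable def combineGate (C : J → Circuit ι) (g : Gate J) :
    Option (Σ j, (C j).Node) → Gate (ι ⊕ Option (Σ j, (C j).Node))
  | none => g.map fun j => embedWire C j (C j).output
  | some ⟨j, x⟩ => ((C j).gate x).map (embedWire C j)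

theorem mem_combineGate_some (C : J → Circuit ι) (g : Gate J) (j : J) (x : (C j).Node)
    (y : Option (Σ j, (C j).Node))
    (h : Sum.inr y ∈ (combineGate C g (some ⟨j, x⟩)).inputs) :
    ∃ z, Sum.inr z ∈ ((C j).gate x).inputs ∧ y = some ⟨j, z⟩ := by
  rw [combineGate, Gate.mem_inputs_map] at h
  obtain ⟨v, hv, e⟩ := h
  cases v with
  | inl i => simp [embedWire] at e
  | inr z => exact ⟨z, hv, by simpa [embedWire, eq_comm] using e⟩

theorem mem_combineGate_none (C : J → Circuit ι) (g : Gate J)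
    (y : Option (Σ j, (C j).Node)) (h : Sum.inr y ∈ (combineGate C g none).inputs) :
    ∃ p, y = some p := by
  rw [combineGate, Gate.mem_inputs_map] at h
  obtain ⟨j, -, e⟩ := h
  cases ho : (C j).output with
  | inl i => simp [embedWire, ho] at e
  | inr z => exact ⟨⟨j, z⟩, by simpa [embedWire, ho, eq_comm] using e⟩

theorem combineGate_acyclic (C : J → Circuit ι) (g : Gate J) :
    WellFounded fun a b => Sum.inr a ∈ (combineGate C g b).inputs := by
  have key : ∀ j x, Acc (fun a b => Sum.inr a ∈ (combineGate C g b).inputs) (some ⟨j, x⟩) := by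
    intro j x
    induction x using (C j).acyclic.induction with
    | _ x ih =>
      refine ⟨_, fun y hy => ?_⟩
      obtain ⟨z, hz, rfl⟩ := mem_combineGate_some C g j x y hy
      exact ih z hz
  refine ⟨fun b => ?_⟩
  cases b with
  | some p => exact key p.1 p.2
  | none =>
    refine ⟨_, fun y hy => ?_⟩
    obtain ⟨p, rfl⟩ := mem_combineGate_none C g y hy
    exact key p.1 p.2

variable [Fintype J]

/-- The disjoint union of a family of circuits, with a new output gate fed by their outputs. -/
noncomputable def combine (C : J → Circuit ι) (g : Gate J) : Circuit ι where
  Node := Option (Σ j, (C j).Node)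
  gate := combineGate C g
  acyclic := combineGate_acyclic C g
  output := Sum.inr none

theorem size_combine (C : J → Circuit ι) (g : Gate J) :
    (combine C g).size = (∑ j, (C j).size) + 1 := by
  change Fintype.card (Option (Σ j, (C j).Node)) = _
  rw [Fintype.card_option, Fintype.card_sigma]
  rfl

theorem wireVal_combine (C : J → Circuit ι) (g : Gate J) (x : ι → Bool) (j : J)
    (w : ι ⊕ (C j).Node) :
    (combine C g).wireVal x (embedWire C j w) ↔ (C j).wireVal x w := by
  cases w with
  | inl i => exact Iff.rfl
  | inr a =>
    change (combine C g).nodeVal x (some ⟨j, a⟩) ↔ (C j).nodeVal x a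
    induction a using (C j).acyclic.induction with
    | _ a ih =>
      refine ((combine C g).nodeVal_iff x (some ⟨j, a⟩)).trans
        ((Gate.eval_map (embedWire C j) ((C j).gate a) _).trans ?_)
      rw [nodeVal_iff]
      have hw : ∀ w ∈ ((C j).gate a).inputs,
          ((combine C g).wireVal x (embedWire C j w) ↔ (C j).wireVal x w) := by
        intro w hw
        cases w with
        | inl i => exact Iff.rfl
        | inr b => exact ih b hw
      revert hw
      cases (C j).gate a with
      | and s => exact fun hw => forall₂_congr hw
      | or s => exact fun hw => exists_congr fun w => and_congr_right (hw w)
      | not w => exact fun hw => not_congr (hw w (Finset.mem_singleton_self w))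

theorem accepts_combine (C : J → Circuit ι) (g : Gate J) (x : ι → Bool) :
    (combine C g).Accepts x ↔ g.eval fun j => (C j).Accepts x := by
  exact ((combine C g).nodeVal_iff x none).trans
    ((Gate.eval_map (fun j => embedWire C j (C j).output) g _).trans
      (Gate.eval_congr g fun j => wireVal_combine C g x j _))

theorem nodeDepth_combine_some (C : J → Circuit ι) (g : Gate J) (j : J) (a : (C j).Node) :
    (combine C g).nodeDepth (some ⟨j, a⟩) ≤ (C j).nodeDepth a := by
  induction a using (C j).acyclic.induction with
  | _ a ih =>
    refine ((combine C g).nodeDepth_eq (some ⟨j, a⟩)).trans_le ?_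
    rw [nodeDepth_eq]
    refine Nat.succ_le_succ (Finset.sup_le fun w hw => ?_)
    cases w with
    | inl i => exact Nat.zero_le _
    | inr y =>
      obtain ⟨z, hz, rfl⟩ := mem_combineGate_some C g j a y hw
      exact (ih z hz).trans
        (Finset.le_sup (f := Sum.elim (fun _ => 0) (C j).nodeDepth) hz)

theorem depth_combine_le (C : J → Circuit ι) (g : Gate J) (h : ℕ) (hC : ∀ j, (C j).depth ≤ h) :
    (combine C g).depth ≤ h + 1 := by
  have hsome : ∀ p, (combine C g).nodeDepth (some p) ≤ h := fun p =>
    (nodeDepth_combine_some C g p.1 p.2).trans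
      ((Finset.le_sup (f := (C p.1).nodeDepth) (Finset.mem_univ p.2)).trans (hC p.1))
  refine Finset.sup_le fun b _ => ?_
  cases b with
  | some p => exact (hsome p).trans (Nat.le_succ h)
  | none =>
    refine ((combine C g).nodeDepth_eq none).trans_le
      (Nat.succ_le_succ (Finset.sup_le fun w hw => ?_))
    cases w with
    | inl i => exact Nat.zero_le _
    | inr y =>
      obtain ⟨p, rfl⟩ := mem_combineGate_none C g y hw
      exact hsome p

/-- The circuit without gates that outputs an input bit. -/
def ofInput (i : ι) : Circuit ι where
  Node := Empty
  gate := nofun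
  acyclic := ⟨nofun⟩
  output := Sum.inl i

end Circuit

/-! ### Closure properties of small circuits of bounded depth -/

/-- `f` is computed by a circuit of size at most `2 ^ a` and depth at most `h`. -/
def CircuitComputable {ι : Type} (a h : ℕ) (f : (ι → Bool) → Prop) : Prop :=
  ∃ C : Circuit ι, C.size ≤ 2 ^ a ∧ C.depth ≤ h ∧ ∀ x, C.Accepts x ↔ f x

namespace CircuitComputable

variable {ι : Type} {a h : ℕ}

theorem mono {a' h' : ℕ} {f : (ι → Bool) → Prop} (hf : CircuitComputable a h f) (ha : a ≤ a')
    (hh : h ≤ h') : CircuitComputable a' h' f := by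
  obtain ⟨C, h1, h2, h3⟩ := hf
  exact ⟨C, h1.trans (Nat.pow_le_pow_right two_pos ha), h2.trans hh, h3⟩

theorem congr {f f' : (ι → Bool) → Prop} (hf : CircuitComputable a h f) (e : ∀ x, f' x ↔ f x) :
    CircuitComputable a h f' := by
  rwa [show f' = f from funext fun x => propext (e x)]

theorem input (i : ι) : CircuitComputable 0 0 fun x : ι → Bool => x i = true :=
  ⟨Circuit.ofInput i, (Fintype.card_empty.trans_le (Nat.zero_le 1)),
    Finset.sup_le (fun b _ => nomatch (b : Empty)), fun _ => Iff.rfl⟩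

/-- The components are placed side by side, without sharing, under one new gate, for a total of at
most `2 ^ b * 2 ^ a + 1` gates. All later size and depth bounds come from iterating this. -/
theorem gate {J : Type} [Fintype J] {b : ℕ} (hJ : Fintype.card J ≤ 2 ^ b) (g : Gate J)
    {f : J → (ι → Bool) → Prop} (hf : ∀ j, CircuitComputable a h (f j)) :
    CircuitComputable (a + b + 1) (h + 1) fun x => g.eval fun j => f j x := by
  choose C h1 h2 h3 using hf
  refine ⟨Circuit.combine C g, ?_, Circuit.depth_combine_le C g h h2, fun x => ?_⟩
  · rw [Circuit.size_combine]
    have h4 : ∑ j, (C j).size ≤ Fintype.card J * 2 ^ a := by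
      simpa using Finset.sum_le_card_nsmul Finset.univ _ _ fun j _ => h1 j
    have h5 : Fintype.card J * 2 ^ a ≤ 2 ^ b * 2 ^ a := Nat.mul_le_mul_right _ hJ
    have h6 : 0 < 2 ^ b * 2 ^ a := by positivity
    calc _ ≤ 2 ^ b * 2 ^ a + 2 ^ b * 2 ^ a := by omega
      _ = 2 ^ (a + b + 1) := by ring
  · rw [Circuit.accepts_combine]
    exact Gate.eval_congr g fun j => h3 j x

theorem not {f : (ι → Bool) → Prop} (hf : CircuitComputable a h f) :
    CircuitComputable (a + 1) (h + 1) fun x => ¬ f x :=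
  gate (b := 0) (J := Unit) (by simp) (.not ()) fun _ => hf

theorem all {J : Type} [Fintype J] {b : ℕ} (hJ : Fintype.card J ≤ 2 ^ b)
    {f : J → (ι → Bool) → Prop} (hf : ∀ j, CircuitComputable a h (f j)) :
    CircuitComputable (a + b + 1) (h + 1) fun x => ∀ j, f j x :=
  (gate hJ (.and Finset.univ) hf).congr fun x => by simp [Gate.eval]

theorem exists_mem {J : Type} [Fintype J] {b : ℕ} (hJ : Fintype.card J ≤ 2 ^ b) (s : Finset J)
    {f : J → (ι → Bool) → Prop} (hf : ∀ j, CircuitComputable a h (f j)) :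
    CircuitComputable (a + b + 1) (h + 1) fun x => ∃ j ∈ s, f j x :=
  gate hJ (.or s) hf

theorem any {J : Type} [Fintype J] {b : ℕ} (hJ : Fintype.card J ≤ 2 ^ b)
    {f : J → (ι → Bool) → Prop} (hf : ∀ j, CircuitComputable a h (f j)) :
    CircuitComputable (a + b + 1) (h + 1) fun x => ∃ j, f j x :=
  (exists_mem hJ Finset.univ hf).congr fun x => by simp

theorem const (P : Prop) : CircuitComputable 1 1 fun _ : ι → Bool => P := by
  by_cases hP : P
  · exact (gate (a := 0) (h := 0) (b := 0) (J := Empty) (f := nofun) (by simp) (.and ∅) nofun).congr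
      fun x => by simp [Gate.eval, hP]
  · exact (gate (a := 0) (h := 0) (b := 0) (J := Empty) (f := nofun) (by simp) (.or ∅) nofun).congr
      fun x => by simp [Gate.eval, hP]

/-- A condition independent of the input is hard-wired: the circuit is either kept or replaced by a
constant one, so neither bound grows. -/
theorem const_and (P : Prop) {f : (ι → Bool) → Prop} (ha : 1 ≤ a) (hh : 1 ≤ h)
    (hf : CircuitComputable a h f) : CircuitComputable a h fun x => P ∧ f x := by
  by_cases hP : P
  · exact hf.congr fun x => by simp [hP]
  · exact ((const False).mono ha hh).congr fun x => by simp [hP]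

theorem and {f f' : (ι → Bool) → Prop} (hf : CircuitComputable a h f)
    (hf' : CircuitComputable a h f') : CircuitComputable (a + 2) (h + 1) fun x => f x ∧ f' x :=
  (all (b := 1) (J := Bool) (f := fun j => if j then f else f') (by simp)
    fun j => by cases j <;> simpa).congr fun x => by simp [and_comm]

theorem or {f f' : (ι → Bool) → Prop} (hf : CircuitComputable a h f)
    (hf' : CircuitComputable a h f') : CircuitComputable (a + 2) (h + 1) fun x => f x ∨ f' x :=
  (any (b := 1) (J := Bool) (f := fun j => if j then f else f') (by simp)
    fun j => by cases j <;> simpa).congr fun x => by simp [or_comm]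

/-- Equality of two input bits. -/
theorem input_eq (i j : ι) : CircuitComputable 5 3 fun x : ι → Bool => x i = x j :=
  ((((input i).and (input j)).mono (a' := 3) (h' := 2) (by norm_num) (by norm_num)).or
    ((input i).not.and (input j).not)).congr fun x => by cases x i <;> cases x j <;> simp

end CircuitComputable

/-! ### Approximate counting by random formulas -/

/-- The fraction of the elements of a finite type that satisfy a predicate. -/
noncomputable def density {α : Type*} [Fintype α] (P : α → Prop) : ℝ :=
  (Nat.card {a // P a} : ℝ) / Fintype.card α

section density

variable {α : Type*} [Fintype α]

theorem density_not [Nonempty α] (P : α → Prop) : density (fun a => ¬ P a) = 1 - density P := by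
  classical
  have h : (Fintype.card α : ℝ) ≠ 0 := by exact_mod_cast Fintype.card_ne_zero
  unfold density
  rw [Nat.card_eq_fintype_card, Nat.card_eq_fintype_card, Fintype.card_subtype_compl,
    Nat.cast_sub (Fintype.card_subtype_le P), sub_div, div_self h]

/-- Independence of the coordinates of a uniformly random tuple. -/
theorem density_forall (k : ℕ) (P : α → Prop) :
    density (fun f : Fin k → α => ∀ i, P (f i)) = density P ^ k := by
  classical
  have e : {f : Fin k → α // ∀ i, P (f i)} ≃ (Fin k → {a // P a}) := Equiv.subtypePiEquivPi
  unfold density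
  rw [Nat.card_congr e, div_pow]
  simp

theorem density_exists [Nonempty α] (k : ℕ) (P : α → Prop) :
    density (fun f : Fin k → α => ∃ i, P (f i)) = 1 - (1 - density P) ^ k := by
  rw [← density_not, ← density_forall, ← density_not]
  simp

/-- The union bound: bad events of total probability below 1 cannot cover the space. -/
theorem exists_forall_not_of_density_lt [Nonempty α] {β : Type*} [Fintype β] (E : β → α → Prop)
    (h : ∀ b, density (E b) < 1 / Fintype.card β) : ∃ a, ∀ b, ¬ E b a := by
  classical
  by_contra! hcon
  have hα : (0 : ℝ) < Fintype.card α := by exact_mod_cast Fintype.card_pos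
  have h1 : Fintype.card α ≤ ∑ b, Nat.card {a // E b a} := by
    calc Fintype.card α = (Finset.univ.biUnion fun b => Finset.univ.filter (E b)).card := by
          rw [← Finset.card_univ]
          congr 1
          ext a
          simpa using hcon a
      _ ≤ ∑ b, (Finset.univ.filter (E b)).card := Finset.card_biUnion_le
      _ = _ := by simp [Fintype.card_subtype]
  obtain ⟨b0, -⟩ := hcon (Classical.arbitrary α)
  have h2 : ∑ b, density (E b) < ∑ _b : β, (1 : ℝ) / Fintype.card β :=
    Finset.sum_lt_sum_of_nonempty ⟨b0, Finset.mem_univ _⟩ fun b _ => h b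
  have hβ : (Fintype.card β : ℝ) ≠ 0 := by
    have : 0 < Fintype.card β := Fintype.card_pos_iff.2 ⟨b0⟩
    positivity
  have h3 : ∑ b, density (E b) = (∑ b, Nat.card {a // E b a} : ℕ) / (Fintype.card α : ℝ) := by
    simp [density, Finset.sum_div]
  rw [h3] at h2
  simp only [Finset.sum_const, Finset.card_univ, nsmul_eq_mul, mul_one_div_cancel hβ] at h2
  rw [div_lt_one hα] at h2
  exact absurd h1 (not_le.2 (by exact_mod_cast h2))

end density

/-- Some power of a number strictly between `0` and `1` is in a prescribed range. -/
theorem exists_pow_mem_range {r B : ℝ} {C : ℕ} (hB : 1 < B) (hr : 1 / B ≤ r) (hr1 : r < 1) :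
    ∃ L : ℕ, r ^ L ≤ (1 / B) ^ C ∧ (1 / B) ^ (C + 1) ≤ r ^ L := by
  classical
  have hB0 : 0 < 1 / B := by positivity
  have hr0 : 0 < r := hB0.trans_le hr
  have hex : ∃ L : ℕ, r ^ L ≤ (1 / B) ^ C := by
    obtain ⟨L, hL⟩ := exists_pow_lt_of_lt_one (show 0 < (1 / B) ^ C by positivity) hr1
    exact ⟨L, hL.le⟩
  -- For the least such exponent the previous power is still above `(1 / B) ^ C`, and one more
  -- factor `r` loses at most a factor `B`.
  refine ⟨Nat.find hex, Nat.find_spec hex, ?_⟩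
  rcases Nat.eq_zero_or_pos (Nat.find hex) with h0 | h0
  · rw [h0, pow_zero]
    exact pow_le_one₀ hB0.le ((div_le_one (by positivity)).2 hB.le)
  · obtain ⟨l, hl⟩ := Nat.exists_eq_succ_of_ne_zero h0.ne'
    have h1 := Nat.find_min hex (m := l) (by omega)
    rw [hl, pow_succ, pow_succ]
    exact mul_le_mul (not_le.1 h1).le hr hB0.le (by positivity)

/-- A monotone formula of depth three: a disjunction of conjunctions of disjunctions. -/
def DepthThreeAccepts {U : Type*} {R Q : ℕ} (φ : Fin R → Fin Q → Finset U) (X : Set U) : Prop :=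
  ∃ r, ∀ q, ∃ u ∈ φ r q, u ∈ X

theorem density_sample {U : Type*} [Fintype U] [Nonempty U] (L Q R : ℕ) (P : U → Prop) :
    density (fun φ : Fin R → Fin Q → Fin L → U => ∃ r, ∀ q, ∃ l, P (φ r q l)) =
      1 - (1 - (1 - (1 - density P) ^ L) ^ Q) ^ R := by
  rw [density_exists (α := Fin Q → Fin L → U) R fun g => ∀ q, ∃ l, P (g q l),
    density_forall (α := Fin L → U) Q fun f => ∃ l, P (f l), density_exists]

/-- A sufficiently sparse input is rejected by most formulas. -/
theorem sample_reject_bound {N q w : ℝ} {n Q : ℕ} (hn : (n : ℝ) = N) (hn2 : 2 ≤ n) (hq : 0 < q)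
    (hqw : q ≤ w) (hw : w ≤ 1) (hQ : 2 * N / q ≤ Q) :
    1 - (1 - (1 - w) ^ Q) ^ n < 1 / 2 ^ n := by
  subst hn
  have h0 : 0 ≤ (1 - w) ^ Q := by have := sub_nonneg.2 hw; positivity
  have h1 : (1 - w) ^ Q ≤ (1 / 4) ^ n := by
    calc (1 - w) ^ Q ≤ Real.exp (-q) ^ Q := by
          refine pow_le_pow_left₀ (sub_nonneg.2 hw) ?_ _
          have := Real.add_one_le_exp (-q)
          linarith
      _ = Real.exp (-(Q * q)) := by rw [← Real.exp_nat_mul]; ring_nf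
      _ ≤ Real.exp (-(n * 2)) := by
          rw [div_le_iff₀ hq] at hQ
          exact Real.exp_le_exp.2 (by linarith)
      _ = Real.exp (-2) ^ n := by rw [← Real.exp_nat_mul]; ring_nf
      _ ≤ (1 / 4) ^ n := by
          refine pow_le_pow_left₀ (Real.exp_pos _).le ?_ _
          rw [Real.exp_neg, one_div]
          refine inv_anti₀ (by norm_num) ?_
          have h := Real.add_one_le_exp 1
          have : Real.exp 2 = Real.exp 1 * Real.exp 1 := by rw [← Real.exp_add]; norm_num
          nlinarith
  -- Bernoulli's inequality acts as the union bound over the `n` conjunctions.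
  have h2 : 1 - (1 - (1 - w) ^ Q) ^ n ≤ n * (1 - w) ^ Q := by
    have h3 : (1 - w) ^ Q ≤ 1 := pow_le_one₀ (sub_nonneg.2 hw) (by linarith)
    have := one_add_mul_le_pow (a := -(1 - w) ^ Q) (by linarith) n
    have e : 1 + -(1 - w) ^ Q = 1 - (1 - w) ^ Q := by ring
    rw [e] at this
    linarith
  have h3 : (n : ℝ) < 2 ^ n := by exact_mod_cast Nat.lt_two_pow_self
  calc _ ≤ n * (1 - w) ^ Q := h2
    _ ≤ n * (1 / 4) ^ n := by gcongr
    _ < 2 ^ n * (1 / 4) ^ n := by gcongr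
    _ = 1 / 2 ^ n := by rw [← mul_pow, ← one_div_pow]; norm_num

/-- A sufficiently dense input is accepted by most formulas. -/
theorem sample_accept_bound {N q w : ℝ} {n Q : ℕ} (hn : (n : ℝ) = N) (hn2 : 2 ≤ n) (hq : 0 < q)
    (hq1 : q ≤ 1) (hw0 : 0 ≤ w) (hw : w ≤ q * (1 / N) ^ 4) (hQ : (Q : ℝ) ≤ 2 * N / q + 1) :
    (1 - (1 - w) ^ Q) ^ n < 1 / 2 ^ n := by
  subst hn
  have hn0 : (2 : ℝ) ≤ n := by exact_mod_cast hn2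
  have hi1 : 1 / (n : ℝ) ≤ 1 / 2 := one_div_le_one_div_of_le (by norm_num) hn0
  have hi0 : 0 < 1 / (n : ℝ) := by positivity
  have hni : (n : ℝ) * (1 / n) = 1 := by field_simp
  have hi3 : (1 / (n : ℝ)) ^ 3 ≤ 1 / 8 := by
    calc _ ≤ (1 / 2 : ℝ) ^ 3 := pow_le_pow_left₀ hi0.le hi1 3
      _ = _ := by norm_num
  have hw1 : w ≤ 1 := by
    have : (1 / (n : ℝ)) ^ 4 ≤ 1 := pow_le_one₀ hi0.le (by linarith)
    calc w ≤ q * (1 / n) ^ 4 := hw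
      _ ≤ 1 * 1 := by gcongr
      _ = 1 := by norm_num
  have h1 : (1 - w) ^ Q ≤ 1 := pow_le_one₀ (sub_nonneg.2 hw1) (by linarith)
  have h2 : 1 - (1 - w) ^ Q ≤ Q * w := by
    have := one_add_mul_le_pow (a := -w) (by linarith) Q
    rw [← sub_eq_add_neg] at this
    linarith
  have h3 : Q * w ≤ 3 / 8 := by
    -- The 1 lost by rounding `Q` up is absorbed, since `n / q` is at least 1.
    have h4 : 2 * n / q + 1 ≤ 3 * n / q := by
      have : 1 ≤ n / q := by rw [le_div_iff₀ hq]; linarith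
      have e : 3 * n / q = 2 * n / q + n / q := by ring
      linarith
    calc Q * w ≤ (3 * n / q) * (q * (1 / n) ^ 4) :=
          mul_le_mul (hQ.trans h4) hw hw0 (by positivity)
      _ = 3 * (n * (1 / n)) * (1 / n) ^ 3 * (q / q) := by ring
      _ = 3 * (1 / n) ^ 3 := by rw [div_self hq.ne', hni]; ring
      _ ≤ 3 / 8 := by linarith
  calc (1 - (1 - w) ^ Q) ^ n ≤ (3 / 8) ^ n := pow_le_pow_left₀ (by linarith) (h2.trans h3) n
    _ < (1 / 2) ^ n := pow_lt_pow_left₀ (by norm_num) (by norm_num) (by omega)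
    _ = _ := by rw [one_div_pow]

/-- Approximate counting by depth three formulas of polynomial size. -/
theorem exists_approximate_counter {U : Type*} [Fintype U] {N : ℕ} (hN : 2 ≤ N)
    (hU : Fintype.card U ≤ N) {t : ℕ} (ht : 0 < t) (a : ℕ) :
    ∃ R ≤ N, ∃ Q ≤ N ^ (4 * t + 4), ∃ φ : Fin R → Fin Q → Finset U, ∀ X : Set U,
      (X.ncard ≤ a → ¬ DepthThreeAccepts φ X) ∧
      (a < X.ncard → (t + 1) * a ≤ t * X.ncard → DepthThreeAccepts φ X) := by
  classical
  have hcard : ∀ X : Set U, X.ncard ≤ Fintype.card U := fun X => by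
    rw [← Nat.card_eq_fintype_card]; exact Set.ncard_le_card X
  rcases le_or_gt (Fintype.card U) a with haU | haU
  · refine ⟨0, Nat.zero_le _, 0, Nat.zero_le _, nofun, fun X => ⟨?_, fun h => ?_⟩⟩
    · rintro - ⟨r, -⟩
      exact r.elim0
    · exact absurd (h.trans_le (hcard X)) haU.not_gt
  rcases Nat.eq_zero_or_pos a with rfl | ha
  -- For `a = 0` the task is to detect nonemptiness, and one disjunction over `U` does it. The
  -- inequality with `t` holds here even for the empty set, which is why `a < X.ncard` is required
  -- separately.
  · refine ⟨1, by omega, 1, Nat.one_le_pow _ _ (by omega), fun _ _ => Finset.univ,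
      fun X => ⟨fun h => ?_, fun h _ => ?_⟩⟩
    · rintro ⟨r, hr⟩
      obtain ⟨u, -, hu⟩ := hr 0
      rw [Nat.le_zero, Set.ncard_eq_zero] at h
      simp [h] at hu
    · obtain ⟨u, hu⟩ := Set.nonempty_of_ncard_ne_zero h.ne'
      exact ⟨0, fun _ => ⟨u, Finset.mem_univ u, hu⟩⟩
  have hU0 : 0 < Fintype.card U := by omega
  have : Nonempty U := Fintype.card_pos_iff.1 hU0
  have ht0 : (0 : ℝ) < t := by exact_mod_cast ht
  obtain ⟨M, hM⟩ : ∃ M, M = Fintype.card U := ⟨_, rfl⟩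
  rw [← hM] at hU haU hcard hU0
  have hM0 : (0 : ℝ) < M := by exact_mod_cast hU0
  have hNR : (2 : ℝ) ≤ N := by exact_mod_cast hN
  have hMN : (M : ℝ) ≤ N := by exact_mod_cast hU
  set r : ℝ := 1 - a / M with hr
  have hr1 : r < 1 := by
    have : 0 < (a : ℝ) / M := by positivity
    linarith
  have hrN : 1 / (N : ℝ) ≤ r := by
    have h1 : (a : ℝ) + 1 ≤ (M : ℝ) := by exact_mod_cast haU
    calc 1 / (N : ℝ) ≤ 1 / M := one_div_le_one_div_of_le hM0 hMN
      _ ≤ (M - a) / M := by gcongr; linarith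
      _ = r := by rw [hr, sub_div, div_self hM0.ne']
  -- With `q = r ^ L`, the upper bound `q ≤ N ^ (-4t)` turns a miss probability `q ^ (1 + 1/t)` into
  -- at most `q * N ^ (-4)`; the lower bound `N ^ (-4t - 1)` keeps `Q` polynomial.
  obtain ⟨L, hL1, hL2⟩ := exists_pow_mem_range (C := 4 * t) (by linarith) hrN hr1
  have hN0 : 0 < 1 / (N : ℝ) := by positivity
  have hr0 : 0 < r := hN0.trans_le hrN
  set q : ℝ := r ^ L with hq
  have hq0 : 0 < q := by positivity
  have hq1 : q ≤ 1 := pow_le_one₀ hr0.le hr1.le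
  set Q : ℕ := ⌈2 * N / q⌉₊ with hQdef
  have hQ1 : 2 * N / q ≤ Q := Nat.le_ceil _
  have hQ2 : (Q : ℝ) ≤ 2 * N / q + 1 := (Nat.ceil_lt_add_one (by positivity)).le
  have hQN : Q ≤ N ^ (4 * t + 4) := by
    rw [hQdef, Nat.ceil_le, div_le_iff₀ hq0]
    push_cast
    calc 2 * (N : ℝ) ≤ N * N := by gcongr
      _ ≤ N ^ 3 := by nlinarith [mul_nonneg (Nat.cast_nonneg' N : (0:ℝ) ≤ N) (Nat.cast_nonneg' N : (0:ℝ) ≤ N)]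
      _ = N ^ (4 * t + 4) * (1 / N) ^ (4 * t + 1) := by
          rw [show 4 * t + 4 = 3 + (4 * t + 1) by ring, pow_add, mul_assoc, ← mul_pow]
          rw [mul_one_div_cancel (by positivity), one_pow, mul_one]
      _ ≤ N ^ (4 * t + 4) * q := by gcongr
  refine ⟨N, le_rfl, Q, hQN, ?_⟩
  have hdens : ∀ X : Set U, density (fun u => u ∈ X) = X.ncard / M := fun X => by
    rw [hM]; rfl
  have hcardX : (Fintype.card (Set U) : ℝ) ≤ 2 ^ N := by
    rw [Fintype.card_set, ← hM]
    exact_mod_cast Nat.pow_le_pow_right two_pos hU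
  have hcardX0 : (0 : ℝ) < Fintype.card (Set U) := by exact_mod_cast Fintype.card_pos
  -- A set can be misjudged in only one direction, depending on its size, so an error below `2 ^
  -- (-N)` for each of at most `2 ^ N` sets suffices.
  obtain ⟨ψ, hψ⟩ := exists_forall_not_of_density_lt
    (α := Fin N → Fin Q → Fin L → U) (β := Set U)
    (fun X ψ => (X.ncard ≤ a ∧ ∃ r, ∀ q, ∃ l, ψ r q l ∈ X) ∨
      ((a < X.ncard ∧ (t + 1) * a ≤ t * X.ncard) ∧ ¬ ∃ r, ∀ q, ∃ l, ψ r q l ∈ X)) (by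
    intro X
    refine lt_of_lt_of_le ?_ (one_div_le_one_div_of_le hcardX0 hcardX)
    have hX0 : 0 ≤ 1 - (X.ncard : ℝ) / M := by
      rw [sub_nonneg, div_le_one hM0]; exact_mod_cast hcard X
    have hX1 : 1 - (X.ncard : ℝ) / M ≤ 1 := by
      have : 0 ≤ (X.ncard : ℝ) / M := by positivity
      linarith
    rcases le_or_gt X.ncard a with hXa | hXa
    · have : (X.ncard ≤ a) = True := by simp [hXa]
      simp only [this, true_and, hXa.not_gt, false_and, or_false]
      rw [density_sample L Q N fun u => u ∈ X, hdens]
      refine sample_reject_bound rfl hN hq0 ?_ (pow_le_one₀ hX0 hX1) hQ1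
      refine pow_le_pow_left₀ hr0.le ?_ L
      rw [hr]
      gcongr
    · simp only [hXa.not_ge, false_and, false_or, hXa, true_and]
      by_cases hX2 : (t + 1) * a ≤ t * X.ncard
      · simp only [hX2, true_and]
        rw [density_not, density_sample L Q N fun u => u ∈ X, hdens, sub_sub_cancel]
        refine sample_accept_bound rfl hN hq0 hq1 (by positivity) ?_ hQ2
        have hX3 : ((t : ℝ) + 1) * a ≤ t * X.ncard := by exact_mod_cast hX2
        -- Bernoulli with exponent `1 + 1/t`: a relative gap in size becomes a power gap between the
        -- miss probabilities.
        have hb : 1 - (X.ncard : ℝ) / M ≤ r ^ (1 + 1 / t : ℝ) := by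
          have hber := one_add_mul_self_le_rpow_one_add (s := -((a : ℝ) / M))
            (by linarith) (p := 1 + 1 / t) (by simp)
          rw [← sub_eq_add_neg] at hber
          refine le_trans ?_ hber
          have : (1 + 1 / t : ℝ) * (a / M) ≤ X.ncard / M := by
            rw [← mul_div_assoc]
            gcongr
            rw [one_add_div ht0.ne', div_mul_eq_mul_div, div_le_iff₀ ht0]
            linarith
          linarith
        have hb2 : (1 - (X.ncard : ℝ) / M) ^ t ≤ r ^ (t + 1) := by
          calc _ ≤ (r ^ (1 + 1 / t : ℝ)) ^ t := pow_le_pow_left₀ hX0 hb t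
            _ = r ^ (t + 1) := by
              rw [← Real.rpow_natCast, ← Real.rpow_mul hr0.le, ← Real.rpow_natCast]
              congr 1
              push_cast
              field_simp
        refine le_of_pow_le_pow_left₀ (n := t) ht.ne' (by positivity) ?_
        calc ((1 - (X.ncard : ℝ) / M) ^ L) ^ t = ((1 - (X.ncard : ℝ) / M) ^ t) ^ L :=
              pow_right_comm _ _ _
          _ ≤ (r ^ (t + 1)) ^ L := by gcongr
          _ = q ^ t * q := by rw [hq, pow_right_comm, pow_succ]
          _ ≤ q ^ t * (1 / N) ^ (4 * t) := by gcongr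
          _ = (q * (1 / N) ^ 4) ^ t := by rw [mul_pow, pow_mul]
      · simp only [hX2, false_and]
        rw [show density (fun _ : Fin N → Fin Q → Fin L → U => False) = 0 by simp [density]]
        positivity)
  -- Passing from samples to sets of elements makes the fan-in at most the size of `U`, so `L` needs
  -- no bound.
  refine ⟨fun r q => Finset.univ.image (ψ r q), fun X => ?_⟩
  have e : DepthThreeAccepts (fun r q => Finset.univ.image (ψ r q)) X ↔
      ∃ r, ∀ q, ∃ l, ψ r q l ∈ X := by
    simp [DepthThreeAccepts]
  have h := hψ X
  rw [e]
  tauto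

open scoped ENNReal

/-! ### Sets of strings of small space-bounded complexity -/

namespace TwoArgTM

variable (V : TwoArgTM)

theorem run_eq_of_halts {p y : List Bool} {T T' : ℕ} (h : V.step p y (V.run p y T) = none)
    (hT : T ≤ T') : V.run p y T' = V.run p y T := by
  induction T', hT using Nat.le_induction with
  | base => rfl
  | succ t _ ih =>
    have e : V.run p y (t + 1) = (V.step p y (V.run p y t)).getD (V.run p y t) :=
      Function.iterate_succ_apply' _ _ _
    rw [e, ih, h, Option.getD_none]

theorem ComputesInSpace.unique {V : TwoArgTM} {s s' : ℕ} {p y x x' : List Bool}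
    (h : V.ComputesInSpace s p y x) (h' : V.ComputesInSpace s' p y x') : x = x' := by
  obtain ⟨T, hT, rfl, -⟩ := h
  obtain ⟨T', hT', rfl, -⟩ := h'
  rcases le_total T T' with hle | hle
  · rw [V.run_eq_of_halts hT hle]
  · rw [V.run_eq_of_halts hT' hle]

theorem ComputesInSpace.mono {V : TwoArgTM} {s s' : ℕ} {p y x : List Bool}
    (h : V.ComputesInSpace s p y x) (hs : s ≤ s') : V.ComputesInSpace s' p y x := by
  obtain ⟨T, h1, h2, h3⟩ := h
  exact ⟨T, h1, h2, h3.trans hs⟩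

theorem KS_lt_iff {s k : ℕ} {x y : List Bool} :
    V.KS s x y < (k : ℕ∞) ↔ ∃ p : List Bool, V.ComputesInSpace s p y x ∧ p.length < k := by
  simp [KS, iInf_lt_iff]

/-- The strings of length `n` of complexity less than `k` conditional on `b` in space `s`. -/
def lowComplexity (n k : ℕ) (b : BitStr n) (s : ℕ) : Set (BitStr n) :=
  {x | V.KS s (List.ofFn x) (List.ofFn b) < (k : ℕ∞)}

theorem lowComplexity_mono (n k : ℕ) (b : BitStr n) : Monotone (V.lowComplexity n k b) := by
  intro s s' hs x hx
  obtain ⟨p, h1, h2⟩ := V.KS_lt_iff.1 hx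
  exact V.KS_lt_iff.2 ⟨p, h1.mono hs, h2⟩

theorem card_lists_length_lt (k : ℕ) :
    Nat.card (Σ i : Fin k, List.Vector Bool i) < 2 ^ k := by
  have h : Nat.card (Σ i : Fin k, List.Vector Bool i) = ∑ i ∈ Finset.range k, 2 ^ i := by
    simp [Finset.sum_range]
  rw [h, Nat.geomSum_eq le_rfl]
  have : 0 < 2 ^ k := by positivity
  omega

/-- By determinism a program has at most one output on `b`, so choosing a short program for each
string is injective. -/
theorem ncard_lowComplexity_lt (n k : ℕ) (b : BitStr n) (s : ℕ) :
    (V.lowComplexity n k b s).ncard < 2 ^ k := by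
  refine lt_of_le_of_lt ?_ (card_lists_length_lt k)
  have h : ∀ x : V.lowComplexity n k b s, ∃ p : List Bool,
      V.ComputesInSpace s p (List.ofFn b) (List.ofFn x.1) ∧ p.length < k :=
    fun x => V.KS_lt_iff.1 x.2
  choose p hp hk using h
  rw [← Nat.card_coe_set_eq]
  refine Nat.card_le_card_of_injective
    (fun x => (⟨⟨(p x).length, hk x⟩, ⟨p x, rfl⟩⟩ : Σ i : Fin k, List.Vector Bool i)) ?_
  intro x x' e
  have e' : p x = p x' := congrArg (fun q : Σ i : Fin k, List.Vector Bool i => q.2.1) e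
  have h1 := hp x
  rw [e'] at h1
  exact Subtype.ext (List.ofFn_injective (h1.unique (hp x')))

end TwoArgTM

theorem ncard_lt_of_mem_relevantSystem {V : TwoArgTM} {n k : ℕ} {S : Set (BitStr n)}
    (hS : S ∈ relevantSystem V n k) : S.ncard < 2 ^ k := by
  obtain ⟨b, s, rfl⟩ := hS
  exact V.ncard_lowComplexity_lt n k b s

theorem card_relevantSystem_le (V : TwoArgTM) (n k : ℕ) :
    Nat.card (relevantSystem V n k) ≤ 2 ^ (2 * n + 1) := by
  have h : ∀ S : relevantSystem V n k, ∃ b s, S.1 = V.lowComplexity n k b s := fun S => S.2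
  choose b s hbs using h
  have hcard : ∀ S : Set (BitStr n), S.ncard < 2 ^ n + 1 := fun S => by
    have := Set.ncard_le_card S
    rw [Nat.card_eq_fintype_card] at this
    simpa [Nat.lt_succ_iff] using this
  -- A set is determined by `b` and its cardinality, because sets with the same `b` are nested.
  refine (Nat.card_le_card_of_injective
    (fun S => ((b S, ⟨S.1.ncard, hcard S.1⟩) : BitStr n × Fin (2 ^ n + 1))) ?_).trans ?_
  · intro S S' e
    simp only [Prod.mk.injEq, Fin.mk.injEq] at e
    obtain ⟨e1, e2⟩ := e
    have h1 := hbs S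
    have h2 := hbs S'
    rw [← e1] at h2
    refine Subtype.ext ?_
    rcases le_total (s S) (s S') with hle | hle
    · refine Set.eq_of_subset_of_ncard_le ?_ e2.ge
      rw [h1, h2]
      exact V.lowComplexity_mono n k _ hle
    · refine (Set.eq_of_subset_of_ncard_le ?_ e2.le).symm
      rw [h1, h2]
      exact V.lowComplexity_mono n k _ hle
  · have : 1 ≤ 2 ^ n := Nat.one_le_two_pow
    simp only [Nat.card_eq_fintype_card, Fintype.card_prod, Fintype.card_fun, Fintype.card_bool,
      Fintype.card_fin]
    calc 2 ^ n * (2 ^ n + 1) ≤ 2 ^ n * (2 ^ n + 2 ^ n) := by gcongr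
      _ = _ := by ring

/-! ### Extractors are low-congesting -/

namespace BipGraph

variable {n m d k : ℕ}

/-- The edges of `G` from `S` to `Y`. -/
def edgesBetween (G : BipGraph n m d) (S : Set (BitStr n)) (Y : Set (BitStr m)) :
    Set (BitStr n × BitStr d) :=
  {q | q.1 ∈ S ∧ G q.1 q.2 ∈ Y}

theorem map_uniform_apply (G : BipGraph n m d) (x : BitStr n) (Y : Set (BitStr m)) :
    ((PMF.uniformOfFintype (BitStr d)).map (G x)).toOuterMeasure Y =
      ({e | G x e ∈ Y}.ncard : ℝ≥0∞) / 2 ^ d := by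
  classical
  rw [PMF.toOuterMeasure_map_apply, PMF.toOuterMeasure_uniformOfFintype_apply]
  rw [← Nat.card_eq_fintype_card, Nat.card_coe_set_eq]
  simp [Set.preimage]

theorem ncard_edgesBetween (G : BipGraph n m d) (S : Finset (BitStr n)) (Y : Set (BitStr m)) :
    (G.edgesBetween S Y).ncard = ∑ x ∈ S, {e | G x e ∈ Y}.ncard := by
  classical
  have h : G.edgesBetween S Y =
      ((S.sigma fun x => Finset.univ.filter fun e => G x e ∈ Y).map
        (Equiv.sigmaEquivProd _ _).toEmbedding : Finset (BitStr n × BitStr d)) := by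
    ext ⟨x, e⟩
    simp [edgesBetween]
  rw [h, Set.ncard_coe_finset, Finset.card_map, Finset.card_sigma]
  refine Finset.sum_congr rfl fun x _ => ?_
  rw [← Set.ncard_coe_finset]
  simp

/-- The extractor property for the uniform distribution on `S`, rewritten as a count of edges. -/
theorem IsExtractor.abs_sub_le {ε : ℝ} {G : BipGraph n m d} (hG : G.IsExtractor k ε)
    {S : Finset (BitStr n)} (hS : S.card = 2 ^ k) (Y : Set (BitStr m)) :
    |((G.edgesBetween S Y).ncard : ℝ) / (2 ^ k * 2 ^ d) - (Y.ncard : ℝ) / 2 ^ m| ≤ ε := by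
  classical
  have hne : S.Nonempty := Finset.card_pos.1 (by rw [hS]; positivity)
  have h := hG (PMF.uniformOfFinset S hne) (fun x => by
    rw [PMF.uniformOfFinset_apply]
    split_ifs
    · rw [hS, ← ENNReal.inv_pow]; simp
    · exact zero_le) Y.toFinset
  rw [Set.coe_toFinset] at h
  have e : (((PMF.uniformOfFinset S hne).bind
      fun x => (PMF.uniformOfFintype (BitStr d)).map (G x)).toOuterMeasure Y).toReal =
      ((G.edgesBetween S Y).ncard : ℝ) / (2 ^ k * 2 ^ d) := by
    rw [PMF.toOuterMeasure_bind_apply]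
    simp_rw [map_uniform_apply]
    rw [tsum_eq_sum (s := S) (fun x hx => by
      rw [PMF.uniformOfFinset_apply_of_notMem hne hx, zero_mul])]
    rw [Finset.sum_congr rfl (fun x hx => by
      rw [PMF.uniformOfFinset_apply_of_mem hne hx])]
    rw [← Finset.mul_sum, ENNReal.toReal_mul, ENNReal.toReal_sum (fun x _ =>
      ENNReal.div_ne_top (ENNReal.natCast_ne_top _) (by positivity)), ncard_edgesBetween, hS]
    simp [← Finset.sum_div]
    field_simp
  rw [e, Set.toFinset_card, ← Nat.card_eq_fintype_card, Nat.card_coe_set_eq] at h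
  exact h

/-- Sum the defining inequality of the clot over its elements; nonemptiness is what keeps the sum
strict. -/
theorem mul_ncard_clot_lt (G : BipGraph n m d) (α : ℝ) (S : Set (BitStr n))
    (h : (G.clot k α S).Nonempty) :
    α * 2 ^ d * 2 ^ k / 2 ^ m * (G.clot k α S).ncard <
      (G.edgesBetween S (G.clot k α S)).ncard := by
  classical
  have e : ((G.edgesBetween S (G.clot k α S)).ncard : ℝ) =
      ∑ y ∈ (G.clot k α S).toFinset,
        ({q : BitStr n × BitStr d | q.1 ∈ S ∧ G q.1 q.2 = y}.ncard : ℝ) := by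
    rw [← Nat.cast_sum, Set.ncard_eq_toFinset_card',
      Finset.card_eq_sum_card_fiberwise (f := fun q : BitStr n × BitStr d => G q.1 q.2)
        (t := (G.clot k α S).toFinset) (fun q hq => by
          exact Set.mem_toFinset.2 (Set.mem_toFinset.1 hq).2)]
    congr 1
    refine Finset.sum_congr rfl fun y hy => ?_
    rw [Set.ncard_eq_toFinset_card']
    congr 1
    ext q
    have hy' : y ∈ G.clot k α S := Set.mem_toFinset.1 hy
    rw [Finset.mem_filter, Set.mem_toFinset, Set.mem_toFinset]
    constructor
    · rintro ⟨⟨h1, -⟩, h3⟩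
      exact ⟨h1, h3⟩
    · rintro ⟨h1, h3⟩
      exact ⟨⟨h1, show G q.1 q.2 ∈ _ from h3 ▸ hy'⟩, h3⟩
  rw [e, Set.ncard_eq_toFinset_card', mul_comm, ← nsmul_eq_mul, ← Finset.sum_const]
  exact Finset.sum_lt_sum_of_nonempty (by simpa using h) fun y hy =>
    show y ∈ G.clot k α S from Set.mem_toFinset.1 hy

/-- In an extractor every set of at most `2 ^ k` left vertices has few `2`-congested vertices. -/
theorem IsExtractor.ncard_congested_lt {ε : ℝ} {G : BipGraph n m d} (hG : G.IsExtractor k ε)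
    (hε : 0 < ε) (hk : k ≤ n) {S : Set (BitStr n)} (hS : S.ncard ≤ 2 ^ k) :
    ((G.congested k 2 S).ncard : ℝ) < 2 * ε * 2 ^ k := by
  classical
  rcases (G.clot k 2 S).eq_empty_or_nonempty with hY | hY
  · have : G.congested k 2 S = ∅ := by
      ext x
      simp [congested, hY]
    rw [this, Set.ncard_empty]
    push_cast
    positivity
  -- A uniform distribution on `S` itself could have too little min-entropy. The enlarged set has
  -- exactly `2 ^ k` elements, and the clot is still that of `S`.
  obtain ⟨S', hSS', hS'⟩ := Finset.exists_superset_card_eq (s := S.toFinset) (n := 2 ^ k)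
    (by rwa [← Set.ncard_eq_toFinset_card'])
    (by simpa using Nat.pow_le_pow_right two_pos hk)
  have hsub : S ⊆ S' := fun x hx => hSS' (by simpa using hx)
  have hext := hG.abs_sub_le hS' (G.clot k 2 S)
  have h1 := (G.mul_ncard_clot_lt (k := k) 2 S hY).trans_le
    (Nat.cast_le.2 (Set.ncard_le_ncard
      (show G.edgesBetween S (G.clot k 2 S) ⊆ G.edgesBetween S' (G.clot k 2 S) from
        fun q hq => ⟨hsub hq.1, hq.2⟩)))
  have h2 : (G.congested k 2 S).ncard * 2 ^ d ≤ (G.edgesBetween S' (G.clot k 2 S)).ncard := by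
    calc _ = ((G.congested k 2 S) ×ˢ (Set.univ : Set (BitStr d))).ncard := by
          rw [Set.ncard_prod, Set.ncard_univ]
          simp
      _ ≤ _ := Set.ncard_le_ncard fun q hq =>
          show q.1 ∈ _ ∧ _ from ⟨hsub hq.1.1, hq.1.2 q.2⟩
  have h2' : ((G.congested k 2 S).ncard : ℝ) * 2 ^ d ≤
      (G.edgesBetween S' (G.clot k 2 S)).ncard := by exact_mod_cast h2
  set E : ℝ := ((G.edgesBetween S' (G.clot k 2 S)).ncard : ℝ)
  set t : ℝ := ((G.congested k 2 S).ncard : ℝ)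
  set c : ℝ := ((G.clot k 2 S).ncard : ℝ)
  have hK : (0 : ℝ) < 2 ^ k := by positivity
  have hD : (0 : ℝ) < 2 ^ d := by positivity
  have hM : (0 : ℝ) < 2 ^ m := by positivity
  have h3 : 2 * (c / 2 ^ m) < E / (2 ^ k * 2 ^ d) := by
    rw [lt_div_iff₀ (by positivity)]
    calc _ = 2 * 2 ^ d * 2 ^ k / 2 ^ m * c := by ring
      _ < E := h1
  have h4 : t / 2 ^ k ≤ E / (2 ^ k * 2 ^ d) := by
    rw [div_le_div_iff₀ hK (by positivity)]
    nlinarith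
  have h5 := (abs_le.1 hext).2
  have h6 : t / 2 ^ k < 2 * ε := by linarith
  rwa [div_lt_iff₀ hK] at h6

end BipGraph

/-! ### The circuit that tests congestion -/

namespace CircuitComputable

variable {ι : Type} {a h : ℕ}

/-- Depth three formulas applied to computable bits. -/
theorem depthThreeAccepts {U : Type} [Fintype U] {R Q b r q : ℕ} (hU : Fintype.card U ≤ 2 ^ b)
    (hR : R ≤ 2 ^ r) (hQ : Q ≤ 2 ^ q) (φ : Fin R → Fin Q → Finset U)
    {f : U → (ι → Bool) → Prop} (hf : ∀ u, CircuitComputable a h (f u)) :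
    CircuitComputable (a + b + q + r + 3) (h + 3)
      fun x => DepthThreeAccepts φ {u | f u x} :=
  ((any (J := Fin R) (b := r) (by simpa) fun i => all (J := Fin Q) (b := q) (by simpa) fun j =>
    exists_mem hU (φ i j) hf).mono (by omega) le_rfl).congr fun _ => Iff.rfl

end CircuitComputable

namespace BipGraph

variable {n m d : ℕ}

/-- Whether two edges have the same right end. -/
theorem sameEnd_computable {T : ℕ} (hm : m ≤ 2 ^ T) (p p' : BitStr n × BitStr d) :
    CircuitComputable (T + 6) 4
      fun w : CodePos n m d → Bool => ∀ j, w (p.1, p.2, j) = w (p'.1, p'.2, j) :=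
  (CircuitComputable.all (J := Fin m) (b := T) (by simpa) fun _ =>
    CircuitComputable.input_eq _ _).mono (by omega) le_rfl

/-- The edges from `S` that have the same right end as the edge `p`, read off from a code. -/
def sameEnd (S : Set (BitStr n)) (w : CodePos n m d → Bool) (p : BitStr n × BitStr d) :
    Set (BitStr n × BitStr d) :=
  {p' | p'.1 ∈ S ∧ ∀ j, w (p'.1, p'.2, j) = w (p.1, p.2, j)}

theorem sameEnd_encode (G : BipGraph n m d) (S : Set (BitStr n)) (p : BitStr n × BitStr d) :
    sameEnd S G.encode p = {q | q.1 ∈ S ∧ G q.1 q.2 = G p.1 p.2} := by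
  ext q
  exact and_congr_right fun _ => funext_iff.symm

/-- The approximately congested vertices, where the size of a set of edges is tested by `φ`. -/
def testedCongested {R Q : ℕ} (φ : Fin R → Fin Q → Finset (BitStr n × BitStr d))
    (S : Set (BitStr n)) (w : CodePos n m d → Bool) : Set (BitStr n) :=
  {x | x ∈ S ∧ ∀ e, DepthThreeAccepts φ (sameEnd S w (x, e))}

/-- The depth 13 is made up of 4 for comparing two edges, 3 for the inner counter, 1 for all edges
of a vertex, 3 for the outer counter, 1 for the negation and 1 for all sets of the system. -/
theorem testedCongested_test_computable {T q q' R Q R' Q' : ℕ} (hT : n + d ≤ T)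
    (hm : m ≤ 2 ^ T) (hR : R ≤ 2 ^ T) (hQ : Q ≤ 2 ^ q) (hR' : R' ≤ 2 ^ T) (hQ' : Q' ≤ 2 ^ q')
    (φ : Fin R → Fin Q → Finset (BitStr n × BitStr d))
    (φ' : Fin R' → Fin Q' → Finset (BitStr n)) {J : Type} [Fintype J]
    (hJ : Fintype.card J ≤ 2 ^ (2 * n + 1)) (S : J → Set (BitStr n)) :
    CircuitComputable (8 * T + q + q' + 16) 13
      fun w : CodePos n m d → Bool =>
        ∀ i, ¬ DepthThreeAccepts φ' (testedCongested φ (S i) w) := by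
  have hU : Fintype.card (BitStr n × BitStr d) ≤ 2 ^ T := by
    simpa [← pow_add] using Nat.pow_le_pow_right two_pos hT
  have h1 : ∀ i (p : BitStr n × BitStr d), CircuitComputable (T + 6 + T + q + T + 3) 7
      fun w : CodePos n m d → Bool => DepthThreeAccepts φ (sameEnd (S i) w p) := fun i p =>
    CircuitComputable.depthThreeAccepts hU hR hQ φ fun p' =>
      CircuitComputable.const_and (p'.1 ∈ S i) (by omega) (by norm_num)
        (sameEnd_computable hm p' p)
  have h2 : ∀ i x, CircuitComputable (T + 6 + T + q + T + 3 + d + 1) 8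
      fun w : CodePos n m d → Bool => x ∈ S i ∧
        ∀ e, DepthThreeAccepts φ (sameEnd (S i) w (x, e)) := fun i x =>
    CircuitComputable.const_and _ (by omega) (by norm_num)
      (CircuitComputable.all (by simp) fun e => h1 i (x, e))
  have h3 := CircuitComputable.all hJ fun i =>
    (CircuitComputable.depthThreeAccepts (b := n) (by simp) hR' hQ' φ' (h2 i)).not
  exact h3.mono (by omega) (by norm_num)

/-- A vertex all of whose edges pass a sound test is congested. -/
theorem testedCongested_subset {R Q k a : ℕ} {φ : Fin R → Fin Q → Finset (BitStr n × BitStr d)}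
    {α : ℝ} (ha : α * 2 ^ d * 2 ^ k / 2 ^ m < a + 1)
    (hφ : ∀ X : Set _, X.ncard ≤ a → ¬ DepthThreeAccepts φ X)
    (G : BipGraph n m d) (S : Set (BitStr n)) :
    testedCongested φ S G.encode ⊆ G.congested k α S := by
  rintro x ⟨hx, h⟩
  refine ⟨hx, fun e => ?_⟩
  have h1 : a + 1 ≤ (sameEnd S G.encode (x, e)).ncard := by
    by_contra! hlt
    exact hφ _ (by omega) (h e)
  rw [sameEnd_encode] at h1
  refine ha.trans_le ?_
  exact_mod_cast h1

/-- A congested vertex passes a complete test. -/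
theorem congested_subset_testedCongested {R Q k : ℕ}
    {φ : Fin R → Fin Q → Finset (BitStr n × BitStr d)} {α : ℝ}
    (hφ : ∀ X : Set _, α * 2 ^ d * 2 ^ k / 2 ^ m < X.ncard → DepthThreeAccepts φ X)
    (G : BipGraph n m d) (S : Set (BitStr n)) :
    G.congested k α S ⊆ testedCongested φ S G.encode := by
  rintro x ⟨hx, h⟩
  refine ⟨hx, fun e => hφ _ ?_⟩
  rw [sameEnd_encode]
  exact h e

end BipGraph

/-! ### Soundness and completeness of the test -/

/-- Without input bits every predicate is computed by a constant circuit. -/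
theorem circuitComputable_of_isEmpty {ι : Type} [IsEmpty ι] (P : (ι → Bool) → Prop) :
    CircuitComputable 1 1 P :=
  (CircuitComputable.const (P isEmptyElim)).congr fun x => by
    rw [Subsingleton.elim x isEmptyElim]

theorem isLowCongesting_of_isExtractor {n m d k : ℕ} {ε : ℝ} {G : BipGraph n m d}
    {V : TwoArgTM} (hε : 0 < ε) (hk : k ≤ n) (hG : G.IsExtractor k ε) :
    G.IsLowCongesting k 2.01 (2.01 * ε) (relevantSystem V n k) := by
  intro S hS
  have h := hG.ncard_congested_lt hε hk (ncard_lt_of_mem_relevantSystem hS).le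
  have hsub : G.congested k 2.01 S ⊆ G.congested k 2 S := fun x hx =>
    ⟨hx.1, fun e => lt_of_le_of_lt
      (show (2 : ℝ) * 2 ^ d * 2 ^ k / 2 ^ m ≤ 2.01 * 2 ^ d * 2 ^ k / 2 ^ m by gcongr; norm_num)
      (hx.2 e)⟩
  calc ((G.congested k 2.01 S).ncard : ℝ) ≤ (G.congested k 2 S).ncard := by
        exact_mod_cast Set.ncard_le_ncard hsub
    _ < 2 * ε * 2 ^ k := h
    _ ≤ 2.01 * ε * 2 ^ k := by gcongr; norm_num

theorem mainTheorem3 :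
    ∃ h : ℕ, ∀ c : ℕ, ∃ A : ℕ,
      ∀ n m d k : ℕ, 1 < k → k < n → 2 ^ n * 2 ^ d * m ≤ 2 ^ (c * n) →
      ∀ ε : ℝ, 0 < ε → ∀ V : TwoArgTM,
        ∃ C : Circuit (CodePos n m d),
          C.size ≤ 2 ^ (A * n) ∧ C.depth ≤ h ∧
          ∀ G : BipGraph n m d,
            (G.IsExtractor k ε → C.Accepts G.encode) ∧
            (C.Accepts G.encode →
              G.IsLowCongesting k 2.01 (2.01 * ε) (relevantSystem V n k)) := by
  classical
  -- The counters must resolve the ratio `2.01 / 2 = 201 / 200 = (t + 1) / t`.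
  obtain ⟨t, ht⟩ : ∃ t, t = 200 := ⟨_, rfl⟩
  refine ⟨13, fun c => ⟨8 * c + c * (4 * t + 4) + c * (4 * t + 4) + 16, fun n m d k hk hkn hc ε hε V => ?_⟩⟩
  -- For `m = 0` the bound on the code length says nothing about `d`, but there is only one graph,
  -- so a constant answer will do.
  rcases Nat.eq_zero_or_pos m with rfl | hm0
  · obtain ⟨C, h1, h2, h3⟩ := circuitComputable_of_isEmpty fun w : CodePos n 0 d → Bool =>
      ∃ G : BipGraph n 0 d, G.encode = w ∧ G.IsExtractor k ε
    refine ⟨C, h1.trans (Nat.pow_le_pow_right two_pos (by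
      have : 1 ≤ (8 * c + c * (4 * t + 4) + c * (4 * t + 4) + 16) * n := by
        refine Nat.mul_pos ?_ ?_ <;> omega
      exact this)), h2.trans (by norm_num),
      fun G => ⟨fun hG => (h3 _).2 ⟨G, rfl, hG⟩, fun hG => ?_⟩⟩
    obtain ⟨G', -, hG'⟩ := (h3 _).1 hG
    rw [Subsingleton.elim G G']
    exact isLowCongesting_of_isExtractor hε hkn.le hG'
  have hm : m ≤ 2 ^ (c * n) := (Nat.le_mul_of_pos_left m (by positivity)).trans hc
  have hT : n + d ≤ c * n := by
    rw [← Nat.pow_le_pow_iff_right (le_refl 2), pow_add]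
    exact (Nat.le_mul_of_pos_right _ hm0).trans hc
  have hN : 2 ≤ 2 ^ (c * n) := by
    simpa using Nat.pow_le_pow_right two_pos (show 1 ≤ c * n by omega)
  have hU : Fintype.card (BitStr n × BitStr d) ≤ 2 ^ (c * n) := by
    simpa [← pow_add] using Nat.pow_le_pow_right two_pos hT
  have hU' : Fintype.card (BitStr n) ≤ 2 ^ (c * n) := by
    simpa using Nat.pow_le_pow_right two_pos (show n ≤ c * n by omega)
  set a : ℕ := ⌊(2 : ℝ) * 2 ^ d * 2 ^ k / 2 ^ m⌋₊
  have ha1 : (a : ℝ) ≤ 2 * 2 ^ d * 2 ^ k / 2 ^ m := Nat.floor_le (by positivity)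
  have ha2 : 2 * 2 ^ d * 2 ^ k / 2 ^ m < (a : ℝ) + 1 := Nat.lt_floor_add_one _
  -- Rounding differs because the inequalities do: the clot needs strictly more than its real
  -- threshold, hence the floor `a`, while fewer than `2 * ε * 2 ^ k` congested vertices means at
  -- most `a'`, the ceiling minus 1.
  obtain ⟨a', haa⟩ : ∃ a', ⌈2 * ε * 2 ^ k⌉₊ = a' + 1 :=
    Nat.exists_eq_succ_of_ne_zero (Nat.ceil_pos.2 (by positivity)).ne'
  have ha3 : (a' : ℝ) < 2 * ε * 2 ^ k := Nat.lt_ceil.1 (by omega)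
  have ha4 : 2 * ε * 2 ^ k ≤ (a' : ℝ) + 1 := by exact_mod_cast haa ▸ Nat.le_ceil (2 * ε * 2 ^ k)
  obtain ⟨R, hR, Q, hQ, φ, hφ⟩ := exists_approximate_counter hN hU (t := t) (by omega) a
  obtain ⟨R', hR', Q', hQ', φ', hφ'⟩ :=
    exists_approximate_counter hN hU' (t := t) (by omega) a'
  rw [← pow_mul] at hQ hQ'
  obtain ⟨C, h1, h2, h3⟩ := BipGraph.testedCongested_test_computable hT hm hR hQ hR' hQ' φ φ'
    (J := relevantSystem V n k)
    (by rw [← Nat.card_eq_fintype_card]; exact card_relevantSystem_le V n k) Subtype.val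
  have hexp : 8 * (c * n) + c * n * (4 * t + 4) + c * n * (4 * t + 4) + 16 ≤
      (8 * c + c * (4 * t + 4) + c * (4 * t + 4) + 16) * n :=
    (Nat.add_le_add_left (show 16 ≤ 16 * n by omega) _).trans_eq (by ring)
  have ht' : (t : ℝ) = 200 := by exact_mod_cast ht
  refine ⟨C, h1.trans (Nat.pow_le_pow_right two_pos hexp), h2, fun G => ?_⟩
  rw [h3]
  constructor
  -- The inner counter never accepts a set of at most `a` edges, so the tested vertices are truly
  -- 2-congested, and the outer counter sees at most `a'` of them.
  · rintro hG ⟨S, hS⟩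
    refine (hφ' _).1 ?_
    have h := hG.ncard_congested_lt hε hkn.le (ncard_lt_of_mem_relevantSystem hS).le
    have h4 := Set.ncard_le_ncard
      (BipGraph.testedCongested_subset (k := k) ha2 (fun X => (hφ X).1) G S)
    have h5 : ((G.congested k 2 S).ncard : ℝ) < a' + 1 := h.trans_le ha4
    have h6 : (G.congested k 2 S).ncard < a' + 1 := by exact_mod_cast h5
    exact h4.trans (Nat.lt_succ_iff.1 h6)
  · intro hG S hS
    -- Conversely, every 2.01-congested vertex passes the inner test; if there were `2.01 * ε * 2 ^
    -- k` of them, their number would exceed `a'` by the ratio at which the outer counter must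
    -- accept.
    by_contra! hlarge
    have h4 := Set.ncard_le_ncard (BipGraph.congested_subset_testedCongested (k := k) (α := 2.01)
      (φ := φ) (fun X hX => by
        have h5 : 2.01 * 2 ^ d * 2 ^ k / 2 ^ m =
          (2.01 / 2 : ℝ) * (2 * 2 ^ d * 2 ^ k / 2 ^ m) := by ring
        rw [h5] at hX
        have h0 : (0 : ℝ) ≤ a := Nat.cast_nonneg _
        have h6 : (a : ℝ) < X.ncard := by linarith
        have h7 : ((t : ℝ) + 1) * a ≤ t * X.ncard := by rw [ht']; linarith
        exact (hφ X).2 (by exact_mod_cast h6) (by exact_mod_cast h7)) G S)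
    have h4' : ((G.congested k 2.01 S).ncard : ℝ) ≤
      (BipGraph.testedCongested φ S G.encode).ncard := by exact_mod_cast h4
    have h5 : 2.01 * ε * 2 ^ k = (2.01 / 2 : ℝ) * (2 * ε * 2 ^ k) := by ring
    rw [h5] at hlarge
    have h0 : (0 : ℝ) ≤ a' := Nat.cast_nonneg _
    have h6 : (a' : ℝ) < (BipGraph.testedCongested φ S G.encode).ncard := by linarith
    have h7 : ((t : ℝ) + 1) * a' ≤ t * (BipGraph.testedCongested φ S G.encode).ncard := by
      rw [ht']; linarith
    exact hG ⟨S, hS⟩ ((hφ' _).2 (by exact_mod_cast h6) (by exact_mod_cast h7))
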